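/- Let $d\ge 1$, let $B_d$ be the open unit ball of $\mathbb{C}^d$ with unit sphere $\partial B_d$, let $\mathbb{D}$ be the open unit disk of $\mathbb{C}$ and $\mathbb{T}=\partial\mathbb{D}$, and let $\sigma_d$ and $\sigma_1$ denote the normalized Lebesgue measures on $\partial B_d$ and $\mathbb{T}$, respectively. Let $\varphi: B_d\to\mathbb{D}$ be a holomorphic function. Then for every $\alpha\in\mathbb{T}$ there is a unique finite positive Borel measure $\sigma_\alpha=\sigma_\alpha[\varphi]$ on $\partial B_d$ (the Clark measure) such that \[ \int_{\partial B_d}\left(\frac{1-|z|^2}{|1-\langle z,\zeta\rangle|^2}\right)^d d\sigma_\alpha(\zeta)=\operatorname{Re}\left(\frac{\alpha+\varphi(z)}{\alpha-\varphi(z)}\right)\quad\text{for all } z\in B_d, \] where $\langle z,\zeta\rangle=\sum_{j=1}^d z_j\overline{\zeta_j}$. Moreover, for every continuous function $f:\partial B_d\to\mathbb{C}$, the function $\alpha\mapsto\int_{\partial B_d} f\,d\sigma_\alpha$ is $\sigma_1$-integrable on $\mathbb{T}$, and \[ \int_{\mathbb{T}}\int_{\partial B_d} f\,d\sigma_\alpha\,d\sigma_1(\alpha)=\int_{\partial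 B_d} f\,d\sigma_d . \] -/

import Mathlib

open MeasureTheory

noncomputable section

namespace ClarkSphere

/-- Complex Euclidean space `ℂ^d`. -/
abbrev Cd (d : ℕ) : Type := EuclideanSpace ℂ (Fin d)

/-- The open unit ball `B_d` of `ℂ^d`. -/
abbrev unitBall (d : ℕ) : Set (Cd d) := Metric.ball (0 : Cd d) 1

/-- The unit sphere `∂B_d` of `ℂ^d`, as a type. -/
abbrev UnitSphere (d : ℕ) : Type := Metric.sphere (0 : Cd d) 1

/-- The unit circle `𝕋 = ∂𝔻`, as a type. -/
abbrev UnitCircle : Type := Metric.sphere (0 : ℂ) 1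

/-- The normalized Lebesgue (surface) measure on the unit sphere of a real normed space `E` with a
reference measure: the surface measure associated with the volume, divided by its total mass. -/
def normalizedSphere (E : Type*) [NormedAddCommGroup E] [NormedSpace ℝ E] [MeasureSpace E] :
    Measure (Metric.sphere (0 : E) 1) :=
  ((volume : Measure E).toSphere Set.univ)⁻¹ • (volume : Measure E).toSphere

/-- The normalized Lebesgue measure `σ_d` on `∂B_d`. -/
def sphereMeasure (d : ℕ) : Measure (UnitSphere d) := normalizedSphere (Cd d)

/-- The normalized Lebesgue measure `σ_1` on `𝕋`. -/
def circleMeasure : Measure UnitCircle := normalizedSphere ℂ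

/-- The invariant Poisson kernel `P(z, ζ) = ((1 - |z|²) / |1 - ⟨z, ζ⟩|²)^d`, where
`⟨z, ζ⟩ = ∑ⱼ zⱼ * conj ζⱼ`, which is `inner ℂ ζ z` here. -/
def invPoissonKernel {d : ℕ} (z ζ : Cd d) : ℝ :=
  ((1 - ‖z‖ ^ 2) / ‖1 - inner ℂ ζ z‖ ^ 2) ^ d

/-- The invariant Poisson integral `P[μ](z)` of a positive measure on `∂B_d`. -/
def invPoissonIntegral {d : ℕ} (μ : Measure (UnitSphere d)) (z : Cd d) : ℝ :=
  ∫ ζ : UnitSphere d, invPoissonKernel z (ζ : Cd d) ∂μ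

/-- `μ` is a finite positive Borel measure on `∂B_d` with
`P[μ](z) = Re ((α + φ z) / (α - φ z))` for all `z ∈ B_d`. -/
def IsClarkMeasure {d : ℕ} (φ : Cd d → ℂ) (α : UnitCircle) (μ : Measure (UnitSphere d)) : Prop :=
  IsFiniteMeasure μ ∧
    ∀ z ∈ unitBall d, invPoissonIntegral μ z = (((α : ℂ) + φ z) / ((α : ℂ) - φ z)).re

open Classical in
/-- The Clark measure `σ_α[φ]` (with the default value `0` if there is none). -/
def clarkMeasure {d : ℕ} (φ : Cd d → ℂ) (α : UnitCircle) : Measure (UnitSphere d) :=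
  if h : ∃ μ : Measure (UnitSphere d), IsClarkMeasure φ α μ then h.choose else 0

end ClarkSphere

end

/-! Fix α and put H = (α + φ)/(α - φ), a holomorphic function on the ball with Re H ≥ 0. Everything
rests on the Cauchy formula on the ball (`integral_mul_cauchyKernel`): for g holomorphic near the
closed ball, integrating g against (1 - ⟨z,ζ⟩)^(-d) gives g(z). To prove it at a point of the line
ℂe, average over the unitaries that fix e and rotate its orthogonal complement. The mean value
property replaces g by its slice on ℂe, and one-variable power series finish: distinct powers of
⟨ζ,e⟩ are orthogonal, and the moments of |⟨ζ,e⟩|², found from Gaussian integrals, are the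
reciprocals of the binomial coefficients in the Cauchy kernel. Multiplying g by a suitable
holomorphic factor turns the Cauchy kernel into the invariant Poisson kernel.

Existence: the measures Re H(rζ) dσ_d have constant mass Re H(0) and Poisson integral Re H(rz), so a
weak limit as r → 1 represents Re H.

Uniqueness: the symmetry P(rη,ζ) = P(rζ,η), Fubini and the approximate identity property show that ∫
f(ζ) P[μ](rζ) dσ_d tends to ∫ f dμ, so P[μ] determines μ.

Disintegration: integrate that limit over α. For fixed |w| < 1 the mean over α of Re((α + w)/(α -
w)) is 1, so each approximant integrates to ∫ f dσ_d; a bound uniform in r and α allows dominated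
convergence. -/

noncomputable section

namespace ClarkSphere

open Filter Topology Metric
open scoped Pointwise ComplexConjugate

/-! ### Invariance of the normalized surface measure, and mean values along orbits. -/

section Invariance

variable {E : Type*} [NormedAddCommGroup E] [NormedSpace ℝ E]

/-- The action of a linear isometry on the unit sphere. -/
def sphereMap (L : E ≃ₗᵢ[ℝ] E) (x : sphere (0 : E) 1) : sphere (0 : E) 1 :=
  ⟨L x, by simp⟩

@[simp]
lemma coe_sphereMap (L : E ≃ₗᵢ[ℝ] E) (x : sphere (0 : E) 1) : (sphereMap L x : E) = L x := rfl

lemma continuous_sphereMap (L : E ≃ₗᵢ[ℝ] E) : Continuous (sphereMap L) :=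
  (L.continuous.comp continuous_subtype_val).subtype_mk _

variable [MeasureSpace E] [BorelSpace E]

lemma measurePreserving_sphereMap (L : E ≃ₗᵢ[ℝ] E)
    (hL : MeasurePreserving L (volume : Measure E) volume) :
    MeasurePreserving (sphereMap L) (normalizedSphere E) (normalizedSphere E) := by
  have key : MeasurePreserving (sphereMap L) (volume : Measure E).toSphere
      (volume : Measure E).toSphere := by
    refine ⟨(continuous_sphereMap L).measurable, ?_⟩
    ext s hs
    rw [Measure.map_apply (continuous_sphereMap L).measurable hs, Measure.toSphere_apply' _ hs,
      Measure.toSphere_apply' _ ((continuous_sphereMap L).measurable hs)]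
    congr 1
    -- Surface measure is, up to the dimension factor, the volume of the truncated cone over the
    -- set, and forming cones commutes with the linear map.
    have hset : Set.Ioo (0 : ℝ) 1 • ((↑) '' (sphereMap L ⁻¹' s) : Set E) =
        L ⁻¹' (Set.Ioo (0 : ℝ) 1 • ((↑) '' s : Set E)) := by
      ext x
      simp only [Set.mem_smul, Set.mem_preimage, Set.mem_image]
      constructor
      · rintro ⟨r, hr, _, ⟨y, hy, rfl⟩, rfl⟩
        exact ⟨r, hr, _, ⟨sphereMap L y, hy, rfl⟩, by simp⟩
      · rintro ⟨r, hr, _, ⟨y, hy, rfl⟩, h⟩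
        refine ⟨r, hr, _, ⟨sphereMap L.symm y, ?_, rfl⟩, ?_⟩
        · have : sphereMap L (sphereMap L.symm y) = y := Subtype.ext (by simp)
          rwa [this]
        · apply L.injective
          simp [← h]
    rw [hset, hL.measure_preimage_emb L.toHomeomorph.measurableEmbedding]
  exact ⟨key.measurable, by rw [normalizedSphere, Measure.map_smul, key.map_eq]⟩

lemma isProbabilityMeasure_normalizedSphere [Nontrivial E] [FiniteDimensional ℝ E]
    [(volume : Measure E).IsAddHaarMeasure] : IsProbabilityMeasure (normalizedSphere E) := by
  constructor
  rw [normalizedSphere, Measure.smul_apply, smul_eq_mul]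
  refine ENNReal.inv_mul_cancel ?_ (measure_ne_top _ _)
  rw [Ne, Measure.measure_univ_eq_zero]
  exact Measure.toSphere_ne_zero _

end Invariance

/-- The action of a unitary map on the unit sphere of `ℂ^d`. -/
def unitaryMap {d : ℕ} (L : Cd d ≃ₗᵢ[ℂ] Cd d) : UnitSphere d → UnitSphere d :=
  sphereMap { L.toLinearEquiv.restrictScalars ℝ with norm_map' := L.norm_map }

@[simp]
lemma coe_unitaryMap {d : ℕ} (L : Cd d ≃ₗᵢ[ℂ] Cd d) (x : UnitSphere d) :
    (unitaryMap L x : Cd d) = L x := rfl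

lemma measurePreserving_unitaryMap {d : ℕ} (L : Cd d ≃ₗᵢ[ℂ] Cd d) :
    MeasurePreserving (unitaryMap L) (sphereMeasure d) (sphereMeasure d) :=
  measurePreserving_sphereMap _ (LinearIsometryEquiv.measurePreserving _)

instance (d : ℕ) [NeZero d] : IsProbabilityMeasure (sphereMeasure d) :=
  isProbabilityMeasure_normalizedSphere

instance : IsProbabilityMeasure circleMeasure :=
  isProbabilityMeasure_normalizedSphere

lemma measurePreserving_rotation (a : Circle) :
    MeasurePreserving (sphereMap (rotation a)) circleMeasure circleMeasure :=
  measurePreserving_sphereMap _ (LinearIsometryEquiv.measurePreserving _)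

lemma integral_comp_of_measurePreserving {X V : Type*} [TopologicalSpace X] [CompactSpace X]
    [MeasurableSpace X] [BorelSpace X] [NormedAddCommGroup V] [NormedSpace ℝ V] {μ : Measure X}
    {T : X → X} (hT : MeasurePreserving T μ μ) {F : X → V} (hF : Continuous F) :
    ∫ x, F (T x) ∂μ = ∫ x, F x ∂μ := by
  conv_rhs => rw [← hT.map_eq]
  rw [integral_map hT.measurable.aemeasurable]
  exact hF.stronglyMeasurable_of_hasCompactSupport (HasCompactSupport.of_compactSpace F)
    |>.aestronglyMeasurable

/-- The mean value property, averaged along a measure-preserving family of maps. -/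
lemma integral_eq_integral_center {X : Type*} [TopologicalSpace X] [CompactSpace X]
    [SecondCountableTopology X]
    [MeasurableSpace X] [BorelSpace X] {μ : Measure X} [IsFiniteMeasure μ] {T : ℝ → X → X}
    (hT : ∀ θ, MeasurePreserving (T θ) μ μ) {F : X → ℂ} (hF : Continuous F)
    (hFT : Continuous fun p : ℝ × X ↦ F (T p.1 p.2)) {G : X → ℂ → ℂ}
    (hG : ∀ x, DiffContOnCl ℂ (G x) (ball 0 1))
    (hFG : ∀ θ x, F (T θ x) = G x (circleMap 0 1 θ)) :
    ∫ x, F x ∂μ = ∫ x, G x 0 ∂μ := by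
  -- On the unit circle `G x` traces F along the orbit of x, so its central value is the orbit
  -- average; Fubini and invariance then remove θ.
  have h1 : ∀ x, G x 0 = (2 * Real.pi)⁻¹ • ∫ θ in (0 : ℝ)..2 * Real.pi, F (T θ x) := by
    intro x
    have : DiffContOnCl ℂ (G x) (ball 0 |1|) := by simpa using hG x
    rw [← this.circleAverage, Real.circleAverage_def]
    simp_rw [hFG]
  obtain ⟨C, hC⟩ : ∃ C, ∀ x, ‖F x‖ ≤ C := by
    obtain ⟨C, hC⟩ := (isCompact_range hF).isBounded.exists_norm_le
    exact ⟨C, fun x ↦ hC _ ⟨x, rfl⟩⟩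
  simp_rw [h1, integral_smul, intervalIntegral.integral_of_le Real.two_pi_pos.le]
  rw [integral_integral_swap]
  · simp_rw [integral_comp_of_measurePreserving (hT _) hF]
    rw [integral_const, measureReal_restrict_apply_univ, Real.volume_real_Ioc_of_le Real.two_pi_pos.le,
      sub_zero, smul_smul, inv_mul_cancel₀ Real.two_pi_pos.ne', one_smul]
  · refine Integrable.of_bound (C := C) ?_ (Eventually.of_forall fun p ↦ hC _)
    exact (hFT.comp continuous_swap).aestronglyMeasurable

/-! ### Polar coordinates and Gaussian computation of spherical moments. -/

/-- Integration in polar coordinates of a function that splits into a spherical and a radial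
part. -/
lemma integral_eq_sphere_mul_radial {E : Type*} [NormedAddCommGroup E] [NormedSpace ℝ E]
    [MeasurableSpace E] [BorelSpace E] [Nontrivial E] [FiniteDimensional ℝ E]
    (μ : Measure E) [μ.IsAddHaarMeasure] {F : E → ℝ} {Φ : sphere (0 : E) 1 → ℝ} {ρ : ℝ → ℝ}
    (hF : ∀ (s : sphere (0 : E) 1) (r : ℝ), 0 < r → F (r • (s : E)) = Φ s * ρ r) :
    ∫ x, F x ∂μ = (∫ s, Φ s ∂μ.toSphere) *
      ∫ r in Set.Ioi (0 : ℝ), r ^ (Module.finrank ℝ E - 1) * ρ r :=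
  calc
    ∫ x, F x ∂μ = ∫ x : ({(0)}ᶜ : Set E), F x.1 ∂(μ.comap (↑)) := by
      rw [integral_subtype_comap (measurableSet_singleton _).compl F, restrict_compl_singleton]
    _ = ∫ p, Φ p.1 * ρ p.2 ∂μ.toSphere.prod (.volumeIoiPow (Module.finrank ℝ E - 1)) := by
      rw [← μ.measurePreserving_homeomorphUnitSphereProd.integral_comp
        (Homeomorph.measurableEmbedding _)]
      refine integral_congr_ae (Eventually.of_forall fun x ↦ ?_)
      have hx := (homeomorphUnitSphereProd E).symm_apply_apply x
      have h2 := hF (homeomorphUnitSphereProd E x).1 (homeomorphUnitSphereProd E x).2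
        (homeomorphUnitSphereProd E x).2.2
      rw [← homeomorphUnitSphereProd_symm_apply_coe, hx] at h2
      exact h2
    _ = (∫ s, Φ s ∂μ.toSphere) *
        ∫ x : Set.Ioi (0 : ℝ), ρ x ∂.volumeIoiPow (Module.finrank ℝ E - 1) :=
      integral_prod_mul Φ fun x : Set.Ioi (0 : ℝ) ↦ ρ x
    _ = _ := by
      simp only [Measure.volumeIoiPow, ENNReal.ofReal]
      rw [integral_withDensity_eq_integral_smul,
        integral_subtype_comap measurableSet_Ioi
          fun a ↦ Real.toNNReal (a ^ (Module.finrank ℝ E - 1)) • ρ a,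
        setIntegral_congr_fun measurableSet_Ioi fun x hx ↦ ?_]
      · rw [NNReal.smul_def, Real.coe_toNNReal _ (pow_nonneg (Set.mem_Ioi.1 hx).le _), smul_eq_mul]
      · exact (measurable_subtype_coe.pow_const _).real_toNNReal

lemma integral_pow_mul_exp_neg_sq (m : ℕ) :
    ∫ r in Set.Ioi (0 : ℝ), r ^ (2 * m + 1) * Real.exp (-r ^ 2) = (m.factorial : ℝ) / 2 := by
  have h := integral_rpow_mul_exp_neg_rpow (p := 2) (q := (2 * m + 1 : ℕ)) (by norm_num)
    (lt_of_lt_of_le (by norm_num) (Nat.cast_nonneg _))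
  have e : (((2 * m + 1 : ℕ) : ℝ) + 1) / 2 = m + 1 := by push_cast; ring
  rw [e, Real.Gamma_nat_eq_factorial] at h
  rw [div_eq_inv_mul, ← one_div, ← h]
  refine setIntegral_congr_fun measurableSet_Ioi fun x hx ↦ ?_
  simp only [Real.rpow_natCast, Real.rpow_ofNat]

lemma integral_norm_pow_mul_exp_neg_sq (k : ℕ) :
    ∫ z : ℂ, ‖z‖ ^ (2 * k) * Real.exp (-‖z‖ ^ 2) = Real.pi * k.factorial := by
  have h := Complex.integral_rpow_mul_exp_neg_rpow (p := 2) (q := (2 * k : ℕ)) (by norm_num)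
    (lt_of_lt_of_le (by norm_num) (Nat.cast_nonneg _))
  have e : (((2 * k : ℕ) : ℝ) + 2) / 2 = k + 1 := by push_cast; ring
  rw [e, Real.Gamma_nat_eq_factorial, mul_div_cancel_left₀ _ two_ne_zero] at h
  rw [← h]
  simp only [Real.rpow_natCast, Real.rpow_ofNat]

/-- The Gaussian splits over the coordinates, and only coordinate 0 carries the extra weight. -/
lemma integral_pi_norm_pow_mul_exp (n k : ℕ) :
    ∫ x : Fin (n + 1) → ℂ, ‖x 0‖ ^ (2 * k) * Real.exp (-∑ i, ‖x i‖ ^ 2) =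
      Real.pi ^ (n + 1) * k.factorial := by
  have h := integral_fintype_prod_volume_eq_prod (𝕜 := ℝ) (E := fun _ : Fin (n + 1) ↦ ℂ)
    (f := Fin.cons (fun z : ℂ ↦ ‖z‖ ^ (2 * k) * Real.exp (-‖z‖ ^ 2))
      (fun _ (z : ℂ) ↦ Real.exp (-‖z‖ ^ 2)))
  have h0 := integral_norm_pow_mul_exp_neg_sq 0
  simp only [mul_zero, pow_zero, one_mul, Nat.factorial_zero, Nat.cast_one, mul_one] at h0
  simp only [Fin.prod_univ_succ, Fin.cons_zero, Fin.cons_succ, integral_norm_pow_mul_exp_neg_sq,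
    h0, Finset.prod_const, Finset.card_univ, Fintype.card_fin] at h
  rw [pow_succ', mul_right_comm, ← h]
  refine integral_congr_ae (Eventually.of_forall fun x ↦ ?_)
  simp only
  rw [Fin.sum_univ_succ, neg_add, Real.exp_add, ← Finset.sum_neg_distrib, Real.exp_sum, mul_assoc]

lemma finrank_Cd (d : ℕ) : Module.finrank ℝ (Cd d) = 2 * d := by
  rw [← Module.finrank_mul_finrank ℝ ℂ (Cd d)]
  simp

/-- The moments of a coordinate on the unit sphere. -/
lemma integral_norm_coord_pow (n k : ℕ) :
    ∫ ζ : UnitSphere (n + 1), ‖(ζ : Cd (n + 1)) 0‖ ^ (2 * k) ∂sphereMeasure (n + 1) =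
      (((k + n).choose n : ℕ) : ℝ)⁻¹ := by
  let e : (Fin (n + 1) → ℂ) ≃L[ℝ] Cd (n + 1) :=
    (PiLp.continuousLinearEquiv 2 ℝ (fun _ : Fin (n + 1) ↦ ℂ)).symm
  have : (Measure.map e volume).IsAddHaarMeasure := e.isAddHaarMeasure_map _
  -- Product volume and Euclidean volume are both Haar measures, hence proportional. The value of c
  -- is not needed: it cancels when the k-th moment is divided by the zeroth.
  obtain ⟨c, hc0, hc⟩ : ∃ c : NNReal, 0 < c ∧
      Measure.map e (volume : Measure (Fin (n + 1) → ℂ)) = c • (volume : Measure (Cd (n + 1))) :=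
    ⟨_, Measure.addHaarScalarFactor_pos_of_isAddHaarMeasure _ _,
      Measure.isAddLeftInvariant_eq_smul _ _⟩
  let J : ℕ → ℝ := fun k ↦
    ∫ ζ : UnitSphere (n + 1), ‖(ζ : Cd (n + 1)) 0‖ ^ (2 * k) ∂(volume : Measure (Cd (n + 1))).toSphere
  -- The same Gaussian integral evaluated twice: coordinatewise on the left, in polar coordinates on
  -- the right.
  have key : ∀ k, Real.pi ^ (n + 1) * k.factorial =
      c * (J k * ((n + k).factorial / 2)) := by
    intro k
    have h1 : ∫ x : Cd (n + 1), ‖x 0‖ ^ (2 * k) * Real.exp (-‖x‖ ^ 2) ∂(Measure.map e volume) =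
        Real.pi ^ (n + 1) * k.factorial := by
      rw [← integral_pi_norm_pow_mul_exp,
        (show MeasurableEmbedding e from e.toHomeomorph.measurableEmbedding).integral_map]
      refine integral_congr_ae (Eventually.of_forall fun x ↦ ?_)
      simp only [EuclideanSpace.norm_sq_eq]
      rfl
    rw [← h1, hc, integral_smul_nnreal_measure, NNReal.smul_def, smul_eq_mul,
      integral_eq_sphere_mul_radial volume
        (Φ := fun ζ : UnitSphere (n + 1) ↦ ‖(ζ : Cd (n + 1)) 0‖ ^ (2 * k))
        (ρ := fun r ↦ r ^ (2 * k) * Real.exp (-r ^ 2)), finrank_Cd, ← integral_pow_mul_exp_neg_sq]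
    · congr 3
      funext x
      rw [← mul_assoc, ← pow_add]
      congr 2
      omega
    · intro s r hr
      simp only [PiLp.smul_apply, norm_smul, Real.norm_eq_abs, abs_of_pos hr, mul_pow]
      rw [norm_eq_of_mem_sphere s]
      ring_nf
  have hJ0 : J 0 = (volume : Measure (Cd (n + 1))).toSphere.real Set.univ := by simp [J]
  have hk := key k
  have h0 := key 0
  have hc' : (0 : ℝ) < c := hc0
  have hJ0' : J 0 ≠ 0 := by
    intro h
    rw [h] at h0
    simp at h0
  have hch : (((k + n).choose n : ℕ) : ℝ) * n.factorial * k.factorial = (n + k).factorial := by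
    rw [mul_right_comm, add_comm n k]
    exact_mod_cast Nat.add_choose_mul_factorial_mul_factorial k n
  have : ∫ ζ : UnitSphere (n + 1), ‖(ζ : Cd (n + 1)) 0‖ ^ (2 * k) ∂sphereMeasure (n + 1) =
      (J 0)⁻¹ * J k := by
    rw [sphereMeasure, normalizedSphere, integral_smul_measure, hJ0, ENNReal.toReal_inv]
    rfl
  rw [this]
  simp only [Nat.factorial_zero, Nat.cast_one, mul_one, add_zero] at h0
  have hch0 : (((k + n).choose n : ℕ) : ℝ) ≠ 0 :=
    Nat.cast_ne_zero.2 (Nat.choose_pos (by omega)).ne'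
  rw [h0, ← hch] at hk
  field_simp
  have h5 : ((c : ℝ) * n.factorial * k.factorial) * J 0 =
    ((c : ℝ) * n.factorial * k.factorial) * (J k * ((k + n).choose n : ℕ)) := by linear_combination 2 * hk
  have := mul_left_cancel₀ (by positivity) h5
  linarith

/-! ### Unitaries adapted to a complex line. -/

section Twist

variable {d : ℕ} {e : Cd d}

lemma inner_sub_inner_smul (he : ‖e‖ = 1) (x : Cd d) :
    inner ℂ e (x - inner ℂ e x • e) = 0 := by
  rw [inner_sub_right, inner_smul_right, inner_self_eq_norm_sq_to_K, he]
  simp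

lemma norm_sq_smul_add_smul (he : ‖e‖ = 1) (x : Cd d) (a b : ℂ) :
    ‖a • e + b • (x - inner ℂ e x • e)‖ ^ 2 =
      ‖a‖ ^ 2 + ‖b‖ ^ 2 * ‖x - inner ℂ e x • e‖ ^ 2 := by
  have := norm_add_sq_eq_norm_sq_add_norm_sq_of_inner_eq_zero (𝕜 := ℂ) (a • e)
    (b • (x - inner ℂ e x • e))
    (by rw [inner_smul_left, inner_smul_right, inner_sub_inner_smul he]; simp)
  rw [sq, this, norm_smul, norm_smul, he]
  ring

/-- The unitary map acting as `a` on `ℂ e` and as `b` on its orthogonal complement. -/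
def twist (he : ‖e‖ = 1) (a b : Circle) : Cd d ≃ₗᵢ[ℂ] Cd d :=
  LinearIsometry.toLinearIsometryEquiv
    { toFun := fun x ↦ ((a : ℂ) * inner ℂ e x) • e + (b : ℂ) • (x - inner ℂ e x • e)
      map_add' := fun x y ↦ by
        simp only [inner_add_right]
        module
      map_smul' := fun c x ↦ by
        simp only [inner_smul_right, RingHom.id_apply]
        module
      norm_map' := fun x ↦ by
        have h1 := norm_sq_smul_add_smul he x (a * inner ℂ e x) b
        have h2 := norm_sq_smul_add_smul he x (inner ℂ e x) 1
        rw [one_smul, add_sub_cancel] at h2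
        simp only [norm_mul, Circle.norm_coe, one_mul, norm_one] at h1 h2
        rw [← h2] at h1
        exact (sq_eq_sq₀ (norm_nonneg _) (norm_nonneg _)).1 h1 } rfl

lemma twist_apply (he : ‖e‖ = 1) (a b : Circle) (x : Cd d) :
    twist he a b x = ((a : ℂ) * inner ℂ e x) • e + (b : ℂ) • (x - inner ℂ e x • e) := rfl

lemma inner_twist (he : ‖e‖ = 1) (a b : Circle) (x : Cd d) :
    inner ℂ e (twist he a b x) = a * inner ℂ e x := by
  rw [twist_apply, inner_add_right, inner_smul_right, inner_smul_right, inner_sub_inner_smul he,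
    inner_self_eq_norm_sq_to_K, he]
  simp

end Twist

lemma norm_inner_le_one {d : ℕ} {e : Cd d} (he : ‖e‖ = 1) (ζ : UnitSphere d) :
    ‖inner ℂ e (ζ : Cd d)‖ ≤ 1 := by
  have := norm_inner_le_norm (𝕜 := ℂ) e (ζ : Cd d)
  rwa [he, norm_eq_of_mem_sphere, one_mul] at this

/-- Termwise integration of a uniformly summable series of continuous functions. -/
lemma hasSum_integral_of_norm_le {X : Type*} [TopologicalSpace X] [CompactSpace X]
    [MeasurableSpace X] [BorelSpace X] {μ : Measure X} [IsFiniteMeasure μ] {F : ℕ → X → ℂ}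
    {G : X → ℂ} {b : ℕ → ℝ} (hF : ∀ k, Continuous (F k)) (hb : Summable b)
    (hFb : ∀ k x, ‖F k x‖ ≤ b k) (hG : ∀ x, HasSum (F · x) (G x)) :
    HasSum (fun k ↦ ∫ x, F k x ∂μ) (∫ x, G x ∂μ) :=
  hasSum_integral_of_dominated_convergence (fun k _ ↦ b k)
    (fun k ↦ ((hF k).stronglyMeasurable_of_hasCompactSupport
      (HasCompactSupport.of_compactSpace _)).aestronglyMeasurable)
    (fun k ↦ Eventually.of_forall (hFb k)) (Eventually.of_forall fun _ ↦ hb)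
    (integrable_const _) (Eventually.of_forall hG)

/-! ### Orthogonality relations and the Cauchy formula for functions of one coordinate. -/

section Moments

variable {n : ℕ} {e : Cd (n + 1)}

/-- Complete e to an orthonormal basis; the unitary sending it to the standard basis reduces the
claim to coordinate 0. -/
lemma integral_norm_inner_pow (he : ‖e‖ = 1) (k : ℕ) :
    ∫ ζ : UnitSphere (n + 1), ‖inner ℂ e (ζ : Cd (n + 1))‖ ^ (2 * k) ∂sphereMeasure (n + 1) =
      (((k + n).choose n : ℕ) : ℝ)⁻¹ := by
  obtain ⟨b, hb⟩ := Orthonormal.exists_orthonormalBasis_extension_of_card_eq (𝕜 := ℂ)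
    (E := Cd (n + 1)) (ι := Fin (n + 1)) (by simp) (v := fun _ ↦ e) (s := {0})
    (by
      rw [orthonormal_iff_ite]
      intro i j
      simp [Subsingleton.elim i j, he])
  have h := integral_comp_of_measurePreserving (measurePreserving_unitaryMap b.repr)
    (F := fun ζ : UnitSphere (n + 1) ↦ ‖(ζ : Cd (n + 1)) 0‖ ^ (2 * k)) (by fun_prop)
  simp only [coe_unitaryMap, OrthonormalBasis.repr_apply_apply, hb 0 rfl] at h
  rw [h, integral_norm_coord_pow]

/-- For j ≠ k, rotating the e-coordinate by a suitable a changes the sign of the integrand while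
preserving the measure. -/
lemma integral_inner_pow_mul_conj_pow (he : ‖e‖ = 1) (j k : ℕ) :
    ∫ ζ : UnitSphere (n + 1), inner ℂ e (ζ : Cd (n + 1)) ^ j * conj (inner ℂ e (ζ : Cd (n + 1))) ^ k
      ∂sphereMeasure (n + 1) = if j = k then ((((k + n).choose n : ℕ) : ℂ))⁻¹ else 0 := by
  split_ifs with h
  · subst h
    have := integral_norm_inner_pow he j
    apply_fun ((↑) : ℝ → ℂ) at this
    rw [← integral_complex_ofReal] at this
    push_cast at this
    rw [← this]
    refine integral_congr_ae (Eventually.of_forall fun ζ ↦ ?_)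
    simp only
    rw [← mul_pow, Complex.mul_conj, Complex.normSq_eq_norm_sq, pow_mul]
    push_cast
    rfl
  · obtain ⟨a, ha⟩ : ∃ a : Circle, (a : ℂ) ^ j * conj (a : ℂ) ^ k = -1 := by
      -- Since conj a = a⁻¹, the requirement is a^(j - k) = -1.
      refine ⟨Circle.exp (Real.pi / ((j : ℝ) - k)), ?_⟩
      have hjk : (j : ℝ) - k ≠ 0 := sub_ne_zero.2 (Nat.cast_injective.ne h)
      have hjk' : (j : ℂ) - k ≠ 0 := sub_ne_zero.2 (Nat.cast_injective.ne h)
      rw [← Circle.coe_inv_eq_conj, ← Circle.exp_neg, Circle.coe_exp, Circle.coe_exp,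
        ← Complex.exp_nat_mul, ← Complex.exp_nat_mul, ← Complex.exp_add, ← Complex.exp_pi_mul_I]
      congr 1
      push_cast
      field_simp
      ring
    have hc : Continuous fun ζ : UnitSphere (n + 1) ↦
        inner ℂ e (ζ : Cd (n + 1)) ^ j * conj (inner ℂ e (ζ : Cd (n + 1))) ^ k := by fun_prop
    have h1 := integral_comp_of_measurePreserving (measurePreserving_unitaryMap (twist he a 1)) hc
    have h2 : ∀ ζ : UnitSphere (n + 1),
        inner ℂ e (unitaryMap (twist he a 1) ζ : Cd (n + 1)) ^ j *
          conj (inner ℂ e (unitaryMap (twist he a 1) ζ : Cd (n + 1))) ^ k =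
        -(inner ℂ e (ζ : Cd (n + 1)) ^ j * conj (inner ℂ e (ζ : Cd (n + 1))) ^ k) := by
      intro ζ
      rw [coe_unitaryMap, inner_twist, map_mul, mul_pow, mul_pow]
      linear_combination (inner ℂ e (ζ : Cd (n + 1)) ^ j *
        conj (inner ℂ e (ζ : Cd (n + 1))) ^ k) * ha
    simp_rw [h2, integral_neg] at h1
    exact self_eq_neg.1 h1.symm

lemma hasSum_mul_choose_mul_pow (n : ℕ) (c : ℂ) {w : ℂ} (hw : ‖w‖ < 1) :
    HasSum (fun k ↦ c * (((k + n).choose n : ℕ) * w ^ k)) (c * (1 / (1 - w) ^ (n + 1))) :=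
  (hasSum_choose_mul_geometric_of_norm_lt_one n hw).mul_left c

/-- Expand the kernel in powers of r conj⟨ζ,e⟩. Only the term k = j survives, and its binomial
coefficient cancels the moment. -/
lemma integral_inner_pow_mul_cauchyKernel (he : ‖e‖ = 1) {r : ℂ} (hr : ‖r‖ < 1) (j : ℕ) :
    ∫ ζ : UnitSphere (n + 1), inner ℂ e (ζ : Cd (n + 1)) ^ j *
      (1 / (1 - r * conj (inner ℂ e (ζ : Cd (n + 1)))) ^ (n + 1)) ∂sphereMeasure (n + 1) =
      r ^ j := by
  have h := hasSum_integral_of_norm_le (μ := sphereMeasure (n + 1))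
    (F := fun k ζ ↦ inner ℂ e (ζ : Cd (n + 1)) ^ j *
      (((k + n).choose n : ℕ) * (r * conj (inner ℂ e (ζ : Cd (n + 1)))) ^ k))
    (G := fun ζ ↦ inner ℂ e (ζ : Cd (n + 1)) ^ j *
      (1 / (1 - r * conj (inner ℂ e (ζ : Cd (n + 1)))) ^ (n + 1)))
    (b := fun k ↦ ((k + n).choose n : ℕ) * ‖r‖ ^ k) (fun k ↦ by fun_prop)
    (summable_choose_mul_geometric_of_norm_lt_one n (by simpa using hr))
    (fun k ζ ↦ by
      rw [norm_mul, norm_mul, norm_pow, norm_pow, norm_mul, RCLike.norm_conj, Complex.norm_natCast]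
      have h1 : ‖inner ℂ e (ζ : Cd (n + 1))‖ ^ j ≤ 1 :=
        pow_le_one₀ (norm_nonneg _) (norm_inner_le_one he ζ)
      have h2 : ‖r‖ * ‖inner ℂ e (ζ : Cd (n + 1))‖ ≤ ‖r‖ :=
        mul_le_of_le_one_right (norm_nonneg _) (norm_inner_le_one he ζ)
      calc _ ≤ 1 * (((k + n).choose n : ℕ) * ‖r‖ ^ k) := by gcongr
        _ = _ := one_mul _)
    (fun ζ ↦ by
      refine hasSum_mul_choose_mul_pow n _ ?_
      rw [norm_mul, RCLike.norm_conj]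
      exact (mul_le_of_le_one_right (norm_nonneg _) (norm_inner_le_one he ζ)).trans_lt hr)
  refine h.unique ?_
  convert hasSum_ite_eq j (r ^ j) using 2 with k
  have : ∀ ζ : UnitSphere (n + 1), inner ℂ e (ζ : Cd (n + 1)) ^ j *
      (((k + n).choose n : ℕ) * (r * conj (inner ℂ e (ζ : Cd (n + 1)))) ^ k) =
      ((k + n).choose n : ℕ) * r ^ k * (inner ℂ e (ζ : Cd (n + 1)) ^ j *
        conj (inner ℂ e (ζ : Cd (n + 1))) ^ k) := fun ζ ↦ by ring
  simp_rw [this]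
  rw [integral_const_mul, integral_inner_pow_mul_conj_pow he]
  rcases eq_or_ne k j with rfl | hkj
  · have : (((k + n).choose n : ℕ) : ℂ) ≠ 0 :=
      Nat.cast_ne_zero.2 (Nat.choose_pos (by omega)).ne'
    simp only [if_true]
    field_simp
  · simp [hkj, hkj.symm]

lemma one_sub_mul_conj_ne_zero {w t : ℂ} (hw : ‖w‖ < 1) (ht : ‖t‖ ≤ 1) : 1 - w * conj t ≠ 0 := by
  intro h
  have h1 : ‖w * conj t‖ = 1 := by rw [← sub_eq_zero.1 h, norm_one]
  rw [norm_mul, RCLike.norm_conj] at h1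
  exact (mul_le_of_le_one_right (norm_nonneg _) ht).trans_lt hw |>.ne h1

lemma integral_slice_mul_cauchyKernel (he : ‖e‖ = 1) {r : ℂ} (hr : ‖r‖ < 1) {h : ℂ → ℂ} {R : ℝ}
    (hR : 1 < R) (hh : DifferentiableOn ℂ h (ball 0 R)) :
    ∫ ζ : UnitSphere (n + 1), h (inner ℂ e (ζ : Cd (n + 1))) *
      (1 / (1 - r * conj (inner ℂ e (ζ : Cd (n + 1)))) ^ (n + 1)) ∂sphereMeasure (n + 1) =
      h r := by
  -- A radius S > 1 makes the Taylor coefficients of h absolutely summable, so the series may be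
  -- integrated termwise over the sphere, where |⟨ζ,e⟩| ≤ 1.
  obtain ⟨S, hS1, hSR⟩ := exists_between hR
  lift S to NNReal using by linarith
  have hp := (hh.mono (closedBall_subset_ball hSR)).hasFPowerSeriesOnBall
    (by exact_mod_cast zero_lt_one.trans hS1)
  set p := cauchyPowerSeries h 0 S
  have hsum : ∀ t : ℂ, ‖t‖ ≤ 1 → HasSum (fun j ↦ p.coeff j * t ^ j) (h t) := by
    intro t ht
    have := hp.hasSum (y := t) (by
      rw [mem_eball, edist_zero_right, enorm_lt_coe]
      exact_mod_cast ht.trans_lt hS1)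
    simpa [FormalMultilinearSeries.apply_eq_pow_smul_coeff, mul_comm] using this
  have hcoeff : Summable fun j ↦ ‖p.coeff j‖ := by
    have := p.summable_norm_mul_pow (r := 1) (lt_of_lt_of_le (by exact_mod_cast hS1) hp.r_le)
    simpa using this
  have hcont : Continuous fun ζ : UnitSphere (n + 1) ↦
      1 / (1 - r * conj (inner ℂ e (ζ : Cd (n + 1)))) ^ (n + 1) := by
    refine continuous_const.div (by fun_prop) fun ζ ↦ pow_ne_zero _ ?_
    exact one_sub_mul_conj_ne_zero hr (norm_inner_le_one he ζ)
  obtain ⟨C, hC⟩ := (isCompact_range hcont).isBounded.exists_norm_le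
  have key := hasSum_integral_of_norm_le (μ := sphereMeasure (n + 1))
    (F := fun j ζ ↦ p.coeff j * (inner ℂ e (ζ : Cd (n + 1)) ^ j *
      (1 / (1 - r * conj (inner ℂ e (ζ : Cd (n + 1)))) ^ (n + 1))))
    (G := fun ζ ↦ h (inner ℂ e (ζ : Cd (n + 1))) *
      (1 / (1 - r * conj (inner ℂ e (ζ : Cd (n + 1)))) ^ (n + 1)))
    (b := fun j ↦ ‖p.coeff j‖ * C) (fun j ↦ by fun_prop) (hcoeff.mul_right C)
    (fun j ζ ↦ by
      rw [norm_mul, norm_mul, norm_pow]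
      have h1 : ‖inner ℂ e (ζ : Cd (n + 1))‖ ^ j ≤ 1 :=
        pow_le_one₀ (norm_nonneg _) (norm_inner_le_one he ζ)
      have h2 := hC _ ⟨ζ, rfl⟩
      have h3 := mul_le_mul h1 h2 (norm_nonneg _) zero_le_one
      rw [one_mul] at h3
      exact mul_le_mul_of_nonneg_left h3 (norm_nonneg _))
    (fun ζ ↦ by
      simp_rw [← mul_assoc]
      exact (hsum _ (norm_inner_le_one he ζ)).mul_right _)
  simp_rw [integral_const_mul, integral_inner_pow_mul_cauchyKernel he hr] at key
  exact key.unique (hsum r hr.le)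

end Moments

lemma integrable_of_continuous {X V : Type*} [TopologicalSpace X] [CompactSpace X]
    [MeasurableSpace X] [BorelSpace X] [NormedAddCommGroup V] {μ : Measure X}
    [IsFiniteMeasure μ] {F : X → V} (hF : Continuous F) : Integrable F μ :=
  hF.integrable_of_hasCompactSupport (HasCompactSupport.of_compactSpace F)

lemma one_sub_inner_ne_zero {d : ℕ} {z ζ : Cd d} (hz : ‖z‖ < 1) (hζ : ‖ζ‖ ≤ 1) :
    1 - inner ℂ ζ z ≠ 0 := by
  intro h
  have h1 : ‖inner ℂ ζ z‖ = 1 := by rw [← sub_eq_zero.1 h, norm_one]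
  have h2 := norm_inner_le_norm (𝕜 := ℂ) ζ z
  have h3 : ‖ζ‖ * ‖z‖ ≤ ‖z‖ := mul_le_of_le_one_left (norm_nonneg _) hζ
  linarith

lemma differentiableOn_div {E : Type*} [NormedAddCommGroup E] [NormedSpace ℂ E] {f g : E → ℂ}
    {s : Set E} (hf : DifferentiableOn ℂ f s) (hg : DifferentiableOn ℂ g s)
    (h : ∀ x ∈ s, g x ≠ 0) : DifferentiableOn ℂ (fun x ↦ f x / g x) s := by
  simp_rw [div_eq_mul_inv]
  exact hf.mul (hg.inv h)

/-! ### The Cauchy and invariant Poisson formulas on the ball. -/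

section Cauchy

variable {n : ℕ}

lemma norm_inner_smul_add_smul_le {d : ℕ} {e : Cd d} (he : ‖e‖ = 1) (ζ : UnitSphere d) {c : ℂ}
    (hc : ‖c‖ ≤ 1) :
    ‖inner ℂ e (ζ : Cd d) • e + c • ((ζ : Cd d) - inner ℂ e (ζ : Cd d) • e)‖ ≤ 1 := by
  have h1 := norm_sq_smul_add_smul he (ζ : Cd d) (inner ℂ e (ζ : Cd d)) c
  have h2 := norm_sq_smul_add_smul he (ζ : Cd d) (inner ℂ e (ζ : Cd d)) 1
  rw [one_smul, add_sub_cancel, norm_eq_of_mem_sphere, norm_one] at h2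
  have h3 : ‖c‖ ^ 2 ≤ 1 ^ 2 := pow_le_pow_left₀ (norm_nonneg _) hc 2
  have h4 := mul_le_mul_of_nonneg_right h3
    (sq_nonneg ‖(ζ : Cd d) - inner ℂ e (ζ : Cd d) • e‖)
  exact (sq_le_sq₀ (norm_nonneg _) zero_le_one).1 (by linarith)

/-- The Cauchy formula on the ball, at a point of the complex line through `e`. -/
lemma integral_mul_cauchyKernel_aux {e : Cd (n + 1)} (he : ‖e‖ = 1) {r : ℂ} (hr : ‖r‖ < 1)
    {g : Cd (n + 1) → ℂ} {R : ℝ} (hR : 1 < R) (hg : DifferentiableOn ℂ g (ball 0 R)) :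
    ∫ ζ : UnitSphere (n + 1), g ζ *
      (1 / (1 - r * conj (inner ℂ e (ζ : Cd (n + 1)))) ^ (n + 1)) ∂sphereMeasure (n + 1) =
      g (r • e) := by
  have hgat : ∀ w : Cd (n + 1), ‖w‖ ≤ 1 → DifferentiableAt ℂ g w := fun w hw ↦
    hg.differentiableAt (isOpen_ball.mem_nhds (by simpa using hw.trans_lt hR))
  have hcont : Continuous fun ζ : UnitSphere (n + 1) ↦
      1 / (1 - r * conj (inner ℂ e (ζ : Cd (n + 1)))) ^ (n + 1) := by
    refine continuous_const.div (by fun_prop) fun ζ ↦ pow_ne_zero _ ?_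
    exact one_sub_mul_conj_ne_zero hr (norm_inner_le_one he ζ)
  have hgc : Continuous fun ζ : UnitSphere (n + 1) ↦ g ζ := continuous_iff_continuousAt.2 fun ζ ↦
    (hgat ζ (norm_eq_of_mem_sphere ζ).le).continuousAt.comp continuous_subtype_val.continuousAt
  have hF : Continuous fun ζ : UnitSphere (n + 1) ↦
      g ζ * (1 / (1 - r * conj (inner ℂ e (ζ : Cd (n + 1)))) ^ (n + 1)) := hgc.mul hcont
  -- The twist fixes the e-component, so the kernel is constant along orbits; c = 0 kills the
  -- orthogonal component and leaves the slice of g on ℂe.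
  rw [integral_eq_integral_center (T := fun θ ↦ unitaryMap (twist he 1 (Circle.exp θ)))
    (fun θ ↦ measurePreserving_unitaryMap _) hF
    (G := fun ζ c ↦ g (inner ℂ e (ζ : Cd (n + 1)) • e +
      c • ((ζ : Cd (n + 1)) - inner ℂ e (ζ : Cd (n + 1)) • e)) *
      (1 / (1 - r * conj (inner ℂ e (ζ : Cd (n + 1)))) ^ (n + 1)))]
  · simp only [zero_smul, add_zero]
    refine integral_slice_mul_cauchyKernel he hr (h := fun t ↦ g (t • e)) hR ?_
    refine hg.comp (by fun_prop) fun t ht ↦ ?_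
    simpa [norm_smul, he] using ht
  · refine hF.comp (Continuous.subtype_mk ?_ _)
    change Continuous fun p : ℝ × UnitSphere (n + 1) ↦ twist he 1 (Circle.exp p.1) p.2
    simp only [twist_apply]
    fun_prop
  · intro ζ
    refine DifferentiableOn.diffContOnCl fun c hc ↦ DifferentiableAt.differentiableWithinAt ?_
    rw [closure_ball _ one_ne_zero, mem_closedBall_zero_iff] at hc
    refine DifferentiableAt.mul_const ?_ _
    exact (hgat _ (norm_inner_smul_add_smul_le he ζ hc)).comp c (by fun_prop)
  · intro θ ζ
    simp only [coe_unitaryMap, inner_twist, Circle.coe_one, one_mul]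
    rw [twist_apply, Circle.coe_one, one_mul, Circle.coe_exp]
    simp [circleMap]

/-- The Cauchy formula on the ball. -/
lemma integral_mul_cauchyKernel {g : Cd (n + 1) → ℂ} {R : ℝ} (hR : 1 < R)
    (hg : DifferentiableOn ℂ g (ball 0 R)) {z : Cd (n + 1)} (hz : ‖z‖ < 1) :
    ∫ ζ : UnitSphere (n + 1), g ζ * (1 / (1 - inner ℂ (ζ : Cd (n + 1)) z) ^ (n + 1))
      ∂sphereMeasure (n + 1) = g z := by
  obtain ⟨e, r, he, hzr⟩ : ∃ (e : Cd (n + 1)) (r : ℂ), ‖e‖ = 1 ∧ r • e = z := by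
    rcases eq_or_ne z 0 with rfl | h
    · exact ⟨EuclideanSpace.single 0 1, 0, by simp, by simp⟩
    · refine ⟨(‖z‖ : ℂ)⁻¹ • z, ‖z‖, ?_, ?_⟩
      · simp [norm_smul, h]
      · rw [smul_smul, mul_inv_cancel₀ (by simpa using h), one_smul]
  subst hzr
  rw [norm_smul, he, mul_one] at hz
  simp_rw [inner_smul_right, ← inner_conj_symm _ e]
  exact integral_mul_cauchyKernel_aux he hz hR hg

/-- The invariant Poisson kernel reproduces functions holomorphic near the closed ball. -/
lemma integral_mul_invPoissonKernel {g : Cd (n + 1) → ℂ} {R : ℝ} (hR : 1 < R)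
    (hg : DifferentiableOn ℂ g (ball 0 R)) {z : Cd (n + 1)} (hz : ‖z‖ < 1) :
    ∫ ζ : UnitSphere (n + 1), g ζ * (invPoissonKernel z (ζ : Cd (n + 1)) : ℂ)
      ∂sphereMeasure (n + 1) = g z := by
  have hz0 : 0 < 1 + ‖z‖ := by positivity
  -- The extra factor is holomorphic in w, equals 1 at w = z, and on the sphere completes the Cauchy
  -- kernel to the Poisson kernel. Its denominator does not vanish for ‖w‖ < 2/(1 + ‖z‖), a radius
  -- exceeding 1, because 2‖z‖ < 1 + ‖z‖.
  have hg2 : DifferentiableOn ℂ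
      (fun w ↦ g w * ((1 - (‖z‖ : ℂ) ^ 2) / (1 - inner ℂ z w)) ^ (n + 1))
      (ball 0 (min R (2 / (1 + ‖z‖)))) := by
    refine (hg.mono (ball_subset_ball (min_le_left _ _))).mul (DifferentiableOn.pow ?_ _)
    have hden : Differentiable ℂ fun w : Cd (n + 1) ↦ 1 - inner ℂ z w :=
      (innerSL ℂ z).differentiable.const_sub 1
    refine differentiableOn_div (differentiableOn_const _) hden.differentiableOn fun w hw h ↦ ?_
    have hw' : ‖w‖ < 2 / (1 + ‖z‖) :=
      (mem_ball_zero_iff.1 hw).trans_le (min_le_right _ _)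
    have h1 : ‖inner ℂ z w‖ = 1 := by rw [← sub_eq_zero.1 h, norm_one]
    have h2 := norm_inner_le_norm (𝕜 := ℂ) z w
    rw [lt_div_iff₀ hz0] at hw'
    nlinarith [norm_nonneg z, norm_nonneg w]
  have h := integral_mul_cauchyKernel
    (lt_min hR (by rw [lt_div_iff₀ hz0]; linarith)) hg2 hz
  have hne : (1 : ℂ) - (‖z‖ : ℂ) ^ 2 ≠ 0 := by
    have : (1 : ℝ) - ‖z‖ ^ 2 ≠ 0 := by nlinarith [norm_nonneg z]
    exact_mod_cast this
  have hzz : inner ℂ z z = (‖z‖ : ℂ) ^ 2 := inner_self_eq_norm_sq_to_K z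
  rw [hzz, div_self hne, one_pow, mul_one] at h
  rw [← h]
  refine integral_congr_ae (Eventually.of_forall fun ζ ↦ ?_)
  simp only [invPoissonKernel]
  have h1 : ((‖1 - inner ℂ (ζ : Cd (n + 1)) z‖ : ℝ) : ℂ) ^ 2 =
      (1 - inner ℂ z (ζ : Cd (n + 1))) * (1 - inner ℂ (ζ : Cd (n + 1)) z) := by
    rw [← Complex.conj_mul']
    simp [inner_conj_symm]
  push_cast
  rw [h1, mul_assoc, one_div, ← inv_pow, ← mul_pow]
  congr 2
  rw [div_mul_eq_div_div, div_eq_mul_inv _ (1 - inner ℂ (ζ : Cd (n + 1)) z)]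

end Cauchy

/-! ### The invariant Poisson kernel as an approximate identity. -/

section PoissonKernel

lemma invPoissonKernel_nonneg {d : ℕ} {z : Cd d} (hz : ‖z‖ < 1) (ζ : Cd d) :
    0 ≤ invPoissonKernel z ζ :=
  pow_nonneg (div_nonneg (by nlinarith [norm_nonneg z]) (sq_nonneg _)) _

lemma continuous_invPoissonKernel {d : ℕ} {X : Type*} [TopologicalSpace X] {z ζ : X → Cd d}
    (hz : Continuous z) (hζ : Continuous ζ) (hz1 : ∀ x, ‖z x‖ < 1) (hζ1 : ∀ x, ‖ζ x‖ ≤ 1) :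
    Continuous fun x ↦ invPoissonKernel (z x) (ζ x) := by
  refine Continuous.pow (Continuous.div (by fun_prop) (by fun_prop) fun x ↦ ?_) _
  exact pow_ne_zero _ (norm_ne_zero_iff.2 (one_sub_inner_ne_zero (hz1 x) (hζ1 x)))

lemma norm_smul_sphere {d : ℕ} {r : ℝ} (hr : 0 ≤ r) (ζ : UnitSphere d) :
    ‖(r : ℂ) • (ζ : Cd d)‖ = r := by
  rw [norm_smul, Complex.norm_real, Real.norm_of_nonneg hr, norm_eq_of_mem_sphere, mul_one]

/-- As r is real, ⟨rη,ζ⟩ and ⟨rζ,η⟩ are complex conjugates. -/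
lemma invPoissonKernel_symm {d : ℕ} (r : ℝ) (η ζ : UnitSphere d) :
    invPoissonKernel ((r : ℂ) • (η : Cd d)) (ζ : Cd d) =
      invPoissonKernel ((r : ℂ) • (ζ : Cd d)) (η : Cd d) := by
  have h : ‖1 - inner ℂ (ζ : Cd d) ((r : ℂ) • (η : Cd d))‖ =
      ‖1 - inner ℂ (η : Cd d) ((r : ℂ) • (ζ : Cd d))‖ := by
    rw [← RCLike.norm_conj]
    simp [inner_conj_symm]
  rw [invPoissonKernel, invPoissonKernel, h, norm_smul, norm_smul, norm_eq_of_mem_sphere,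
    norm_eq_of_mem_sphere]

lemma integral_invPoissonKernel {n : ℕ} {z : Cd (n + 1)} (hz : ‖z‖ < 1) :
    ∫ ζ : UnitSphere (n + 1), invPoissonKernel z (ζ : Cd (n + 1)) ∂sphereMeasure (n + 1) = 1 := by
  have h := integral_mul_invPoissonKernel (g := fun _ ↦ 1) one_lt_two
    (differentiableOn_const _) hz
  simp only [one_mul] at h
  rw [integral_complex_ofReal] at h
  exact_mod_cast h

/-- On the sphere Re⟨η,ζ⟩ = 1 - |ζ - η|²/2 ≤ 1 - δ²/2. The bound δ ≤ 1 keeps the right side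
nonnegative, so it survives multiplication by r. -/
lemma invPoissonKernel_le {d : ℕ} {r δ : ℝ} (hr0 : 0 ≤ r) (hr1 : r < 1) (hδ0 : 0 < δ) (hδ1 : δ ≤ 1)
    {η ζ : UnitSphere d} (h : δ ≤ dist ζ η) :
    invPoissonKernel ((r : ℂ) • (η : Cd d)) (ζ : Cd d) ≤ ((1 - r ^ 2) / (δ ^ 2 / 2) ^ 2) ^ d := by
  have h1 : ‖(ζ : Cd d) - η‖ ^ 2 = 2 - 2 * (inner ℂ (ζ : Cd d) (η : Cd d)).re := by
    have := norm_sub_sq (𝕜 := ℂ) (ζ : Cd d) (η : Cd d)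
    rw [norm_eq_of_mem_sphere, norm_eq_of_mem_sphere, RCLike.re_eq_complex_re] at this
    linarith
  have h2 : δ ^ 2 ≤ ‖(ζ : Cd d) - η‖ ^ 2 := by
    rw [← dist_eq_norm, ← Subtype.dist_eq]
    exact pow_le_pow_left₀ hδ0.le h 2
  have h3 : δ ^ 2 / 2 ≤ ‖1 - inner ℂ (ζ : Cd d) ((r : ℂ) • (η : Cd d))‖ := by
    refine le_trans ?_ (Complex.re_le_norm _)
    rw [inner_smul_right, Complex.sub_re, Complex.one_re, Complex.re_ofReal_mul]
    have h4 : (inner ℂ (ζ : Cd d) (η : Cd d)).re ≤ 1 - δ ^ 2 / 2 := by linarith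
    have h5 := mul_le_mul_of_nonneg_left h4 hr0
    have h6 : r * (1 - δ ^ 2 / 2) ≤ 1 * (1 - δ ^ 2 / 2) := by
      gcongr
      nlinarith
    linarith
  rw [invPoissonKernel, norm_smul_sphere hr0]
  have h4 : 0 ≤ 1 - r ^ 2 := by nlinarith
  gcongr

/-- The Poisson integral of a continuous function converges radially to the function. -/
lemma tendsto_integral_mul_invPoissonKernel {n : ℕ} {f : UnitSphere (n + 1) → ℂ}
    (hf : Continuous f) {r : ℕ → ℝ} (hr0 : ∀ m, 0 ≤ r m) (hr1 : ∀ m, r m < 1)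
    (hr : Tendsto r atTop (𝓝 1)) (η : UnitSphere (n + 1)) :
    Tendsto (fun m ↦ ∫ ζ : UnitSphere (n + 1),
      f ζ * (invPoissonKernel ((r m : ℂ) • (η : Cd (n + 1))) (ζ : Cd (n + 1)) : ℂ)
      ∂sphereMeasure (n + 1)) atTop (𝓝 (f η)) := by
  obtain ⟨C, hC⟩ : ∃ C, ∀ x, ‖f x‖ ≤ C := by
    obtain ⟨C, hC⟩ := (isCompact_range hf).isBounded.exists_norm_le
    exact ⟨C, fun x ↦ hC _ ⟨x, rfl⟩⟩
  have hC0 : 0 ≤ C := (norm_nonneg _).trans (hC η)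
  rw [Metric.tendsto_atTop']
  intro ε hε
  obtain ⟨δ', hδ', hfδ⟩ := Metric.continuous_iff.1 hf η (ε / 2) (half_pos hε)
  obtain ⟨δ, hδ, hδ1, hδδ⟩ : ∃ δ : ℝ, 0 < δ ∧ δ ≤ 1 ∧ δ ≤ δ' :=
    ⟨min 1 δ', lt_min one_pos hδ', min_le_left _ _, min_le_right _ _⟩
  have hlim : Tendsto (fun m ↦ 2 * C * ((1 - r m ^ 2) / (δ ^ 2 / 2) ^ 2) ^ (n + 1)) atTop (𝓝 0) := by
    have := (((((hr.pow 2).const_sub 1).div_const ((δ ^ 2 / 2) ^ 2)).pow (n + 1)).const_mul (2 * C))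
    simpa using this
  obtain ⟨N, hN⟩ := eventually_atTop.1 (hlim.eventually_lt_const (half_pos hε))
  refine ⟨N, fun m hm ↦ ?_⟩
  have hz : ‖(r m : ℂ) • (η : Cd (n + 1))‖ < 1 := by
    rw [norm_smul_sphere (hr0 m)]; exact hr1 m
  have hP : Continuous fun ζ : UnitSphere (n + 1) ↦
      invPoissonKernel ((r m : ℂ) • (η : Cd (n + 1))) (ζ : Cd (n + 1)) :=
    continuous_invPoissonKernel continuous_const continuous_subtype_val (fun _ ↦ hz)
      fun ζ ↦ (norm_eq_of_mem_sphere ζ).le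
  set P : UnitSphere (n + 1) → ℝ := fun ζ ↦
      invPoissonKernel ((r m : ℂ) • (η : Cd (n + 1))) (ζ : Cd (n + 1)) with hPdef
  set B := 2 * C * ((1 - r m ^ 2) / (δ ^ 2 / 2) ^ 2) ^ (n + 1) with hB
  have hB0 : 0 ≤ B := by
    have : 0 ≤ 1 - r m ^ 2 := by nlinarith [hr0 m, hr1 m]
    positivity
  have hP0 : ∀ ζ, 0 ≤ P ζ := fun ζ ↦ invPoissonKernel_nonneg hz _
  have h1 : ∫ ζ, (P ζ : ℂ) ∂sphereMeasure (n + 1) = 1 := by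
    rw [integral_complex_ofReal, integral_invPoissonKernel hz, Complex.ofReal_one]
  have h2 : (∫ ζ, f ζ * (P ζ : ℂ) ∂sphereMeasure (n + 1)) - f η =
      ∫ ζ, (f ζ - f η) * (P ζ : ℂ) ∂sphereMeasure (n + 1) := by
    simp_rw [sub_mul]
    rw [integral_sub (integrable_of_continuous (by fun_prop))
      (integrable_of_continuous (by fun_prop)), integral_const_mul, h1, mul_one]
  -- Near η continuity of f gives the first term; away from η the kernel itself is small, which
  -- gives B.
  have h3 : ∀ ζ, ‖(f ζ - f η) * (P ζ : ℂ)‖ ≤ ε / 2 * P ζ + B := by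
    intro ζ
    rw [norm_mul, Complex.norm_real, Real.norm_of_nonneg (hP0 ζ)]
    rcases lt_or_ge (dist ζ η) δ with h | h
    · have := hfδ ζ (h.trans_le hδδ)
      rw [dist_eq_norm] at this
      have := mul_le_mul_of_nonneg_right this.le (hP0 ζ)
      linarith
    · have h4 : ‖f ζ - f η‖ ≤ 2 * C := (norm_sub_le _ _).trans (by linarith [hC ζ, hC η])
      have h5 := mul_le_mul h4 (invPoissonKernel_le (hr0 m) (hr1 m) hδ hδ1 h) (hP0 ζ) (by positivity)
      have h6 : 0 ≤ ε / 2 * P ζ := mul_nonneg (half_pos hε).le (hP0 ζ)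
      linarith
  rw [dist_eq_norm, h2]
  calc _ ≤ ∫ ζ, (ε / 2 * P ζ + B) ∂sphereMeasure (n + 1) :=
        norm_integral_le_of_norm_le (integrable_of_continuous (by fun_prop))
          (Eventually.of_forall h3)
    _ = ε / 2 + B := by
        rw [integral_add (integrable_of_continuous (by fun_prop)) (integrable_const _),
          integral_const_mul, integral_invPoissonKernel hz]
        simp
    _ < ε := by linarith [hN m hm.le]

end PoissonKernel

lemma norm_smul_lt_one {d : ℕ} {r : ℝ} (hr0 : 0 ≤ r) (hr1 : r < 1) {z : Cd d} (hz : ‖z‖ ≤ 1) :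
    ‖(r : ℂ) • z‖ < 1 := by
  rw [norm_smul, Complex.norm_real, Real.norm_of_nonneg hr0]
  exact (mul_le_of_le_one_right hr0 hz).trans_lt hr1

@[simp]
lemma invPoissonKernel_zero {d : ℕ} (ζ : Cd d) : invPoissonKernel 0 ζ = 1 := by
  simp [invPoissonKernel]

/-! ### Representing measures: existence by weak compactness, recovery by radial limits. -/

section Representation

variable {n : ℕ}

/-- The dilate w ↦ H(rw) is holomorphic on the ball of radius 2/(1 + r) > 1, so the reproducing
formula applies, and the kernel is real. -/
lemma integral_invPoissonKernel_mul_re {H : Cd (n + 1) → ℂ}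
    (hH : DifferentiableOn ℂ H (unitBall (n + 1))) {r : ℝ} (hr0 : 0 ≤ r) (hr1 : r < 1)
    {z : Cd (n + 1)} (hz : ‖z‖ < 1) :
    ∫ ζ : UnitSphere (n + 1), (H ((r : ℂ) • (ζ : Cd (n + 1)))).re *
      invPoissonKernel z (ζ : Cd (n + 1)) ∂sphereMeasure (n + 1) = (H ((r : ℂ) • z)).re := by
  have hr2 : 0 < 1 + r := by linarith
  have hg : DifferentiableOn ℂ (fun w ↦ H ((r : ℂ) • w)) (ball 0 (2 / (1 + r))) := by
    refine hH.comp (by fun_prop) fun w hw ↦ ?_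
    rw [mem_ball_zero_iff, lt_div_iff₀ hr2] at hw
    rw [mem_ball_zero_iff, norm_smul, Complex.norm_real, Real.norm_of_nonneg hr0]
    nlinarith [norm_nonneg w]
  have hR : 1 < 2 / (1 + r) := by rw [lt_div_iff₀ hr2]; linarith
  have hcont : Continuous fun ζ : UnitSphere (n + 1) ↦ H ((r : ℂ) • (ζ : Cd (n + 1))) :=
    hH.continuousOn.comp_continuous (by fun_prop) fun ζ ↦
      mem_ball_zero_iff.2 (norm_smul_lt_one hr0 hr1 (norm_eq_of_mem_sphere ζ).le)
  have hP : Continuous fun ζ : UnitSphere (n + 1) ↦ invPoissonKernel z (ζ : Cd (n + 1)) :=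
    continuous_invPoissonKernel continuous_const continuous_subtype_val (fun _ ↦ hz)
      fun ζ ↦ (norm_eq_of_mem_sphere ζ).le
  rw [← integral_mul_invPoissonKernel hR hg hz, ← RCLike.re_eq_complex_re, ← integral_re]
  · simp
  · exact integrable_of_continuous (hcont.mul (Complex.continuous_ofReal.comp hP))

/-- A holomorphic function with nonnegative real part on the ball is, in real part, the invariant
Poisson integral of a finite positive measure. -/
lemma exists_isFiniteMeasure_invPoissonIntegral_eq {H : Cd (n + 1) → ℂ}
    (hH : DifferentiableOn ℂ H (unitBall (n + 1))) (hpos : ∀ z ∈ unitBall (n + 1), 0 ≤ (H z).re) :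
    ∃ μ : Measure (UnitSphere (n + 1)), IsFiniteMeasure μ ∧
      ∀ z ∈ unitBall (n + 1), invPoissonIntegral μ z = (H z).re := by
  obtain ⟨r, -, hr01, hr⟩ := exists_seq_strictMono_tendsto' (zero_lt_one (α := ℝ))
  have hr0 : ∀ m, 0 ≤ r m := fun m ↦ (hr01 m).1.le
  have hr1 : ∀ m, r m < 1 := fun m ↦ (hr01 m).2
  let w : ℕ → UnitSphere (n + 1) → ℝ := fun m ζ ↦ (H ((r m : ℂ) • (ζ : Cd (n + 1)))).re
  have hmem : ∀ m (ζ : UnitSphere (n + 1)), (r m : ℂ) • (ζ : Cd (n + 1)) ∈ unitBall (n + 1) :=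
    fun m ζ ↦ mem_ball_zero_iff.2
      (norm_smul_lt_one (hr0 m) (hr1 m) (norm_eq_of_mem_sphere ζ).le)
  have hw : ∀ m, Continuous (w m) := fun m ↦ Complex.continuous_re.comp
    (hH.continuousOn.comp_continuous (by fun_prop) (hmem m))
  have hw0 : ∀ m ζ, 0 ≤ w m ζ := fun m ζ ↦ hpos _ (hmem m ζ)
  have hmass : ∀ m, (sphereMeasure (n + 1)).withDensity (fun ζ ↦ ENNReal.ofReal (w m ζ)) Set.univ =
      ENNReal.ofReal (H 0).re := by
    intro m
    rw [withDensity_apply _ MeasurableSet.univ, Measure.restrict_univ,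
      ← ofReal_integral_eq_lintegral_ofReal (integrable_of_continuous (hw m))
        (Eventually.of_forall (hw0 m))]
    have := integral_invPoissonKernel_mul_re hH (hr0 m) (hr1 m) (z := 0) (by simp)
    simp only [invPoissonKernel_zero, mul_one, smul_zero] at this
    rw [← this]
  let ν : ℕ → FiniteMeasure (UnitSphere (n + 1)) := fun m ↦
    ⟨(sphereMeasure (n + 1)).withDensity (fun ζ ↦ ENNReal.ofReal (w m ζ)),
      ⟨by rw [hmass]; exact ENNReal.ofReal_lt_top⟩⟩
  have : T2Space (UnitSphere (n + 1)) := Topology.IsEmbedding.subtypeVal.t2Space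
  have hK := isCompact_setOfPred_finiteMeasure_le_of_compactSpace (UnitSphere (n + 1))
    (H 0).re.toNNReal
  -- Measures of mass at most Re H(0) form a weakly compact set, so a limit exists along a free
  -- ultrafilter and no subsequence has to be extracted.
  obtain ⟨μ, -, hμ⟩ := hK.ultrafilter_le_nhds ((hyperfilter ℕ).map ν) (by
    rw [le_principal_iff]
    refine mem_map.2 (Filter.univ_mem' fun m ↦ ?_)
    change (ν m).mass ≤ _
    rw [← ENNReal.coe_le_coe, FiniteMeasure.ennreal_mass]
    exact (hmass m).le)
  have hlim : Tendsto ν (hyperfilter ℕ) (𝓝 μ) := hμ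
  refine ⟨μ, inferInstance, fun z hz ↦ ?_⟩
  have hz1 : ‖z‖ < 1 := mem_ball_zero_iff.1 hz
  have hP : Continuous fun ζ : UnitSphere (n + 1) ↦ invPoissonKernel z (ζ : Cd (n + 1)) :=
    continuous_invPoissonKernel continuous_const continuous_subtype_val (fun _ ↦ hz1)
      fun ζ ↦ (norm_eq_of_mem_sphere ζ).le
  have h1 := FiniteMeasure.tendsto_iff_forall_integral_tendsto.1 hlim
    (BoundedContinuousFunction.mkOfCompact ⟨_, hP⟩)
  have h2 : Tendsto (fun m ↦ (H ((r m : ℂ) • z)).re) atTop (𝓝 (H z).re) := by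
    have hc : ContinuousAt H z := hH.continuousOn.continuousAt (isOpen_ball.mem_nhds hz)
    have h3 : Tendsto (fun m ↦ (r m : ℂ) • z) atTop (𝓝 z) := by
      have := ((Complex.continuous_ofReal.tendsto 1).comp hr).smul_const z
      simpa using this
    exact (Complex.continuous_re.tendsto _).comp (hc.tendsto.comp h3)
  refine tendsto_nhds_unique h1 ((h2.mono_left Nat.hyperfilter_le_atTop).congr fun m ↦ ?_)
  rw [← integral_invPoissonKernel_mul_re hH (hr0 m) (hr1 m) hz1]
  change _ = ∫ ζ : UnitSphere (n + 1), invPoissonKernel z (ζ : Cd (n + 1))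
    ∂((sphereMeasure (n + 1)).withDensity fun ζ ↦ ENNReal.ofReal (w m ζ))
  rw [integral_withDensity_eq_integral_toReal_smul (hw m).measurable.ennreal_ofReal
    (Eventually.of_forall fun _ ↦ ENNReal.ofReal_lt_top)]
  refine integral_congr_ae (Eventually.of_forall fun ζ ↦ ?_)
  simp only
  rw [ENNReal.toReal_ofReal (hw0 m ζ), smul_eq_mul]

/-- A measure is recovered from its invariant Poisson integral by radial limits. -/
lemma tendsto_integral_mul_of_invPoissonIntegral_eq {μ : Measure (UnitSphere (n + 1))}
    [IsFiniteMeasure μ] {u : Cd (n + 1) → ℝ}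
    (hμ : ∀ z ∈ unitBall (n + 1), invPoissonIntegral μ z = u z)
    {f : UnitSphere (n + 1) → ℂ} (hf : Continuous f) {r : ℕ → ℝ} (hr0 : ∀ m, 0 ≤ r m)
    (hr1 : ∀ m, r m < 1) (hr : Tendsto r atTop (𝓝 1)) :
    Tendsto (fun m ↦ ∫ ζ : UnitSphere (n + 1), f ζ * (u ((r m : ℂ) • (ζ : Cd (n + 1))) : ℂ)
      ∂sphereMeasure (n + 1)) atTop (𝓝 (∫ ζ, f ζ ∂μ)) := by
  obtain ⟨C, hC⟩ : ∃ C, ∀ x, ‖f x‖ ≤ C := by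
    obtain ⟨C, hC⟩ := (isCompact_range hf).isBounded.exists_norm_le
    exact ⟨C, fun x ↦ hC _ ⟨x, rfl⟩⟩
  have hz : ∀ m (η : UnitSphere (n + 1)), ‖(r m : ℂ) • (η : Cd (n + 1))‖ < 1 := fun m η ↦
    norm_smul_lt_one (hr0 m) (hr1 m) (norm_eq_of_mem_sphere η).le
  have hPc : ∀ m, Continuous fun p : UnitSphere (n + 1) × UnitSphere (n + 1) ↦
      f p.2 * (invPoissonKernel ((r m : ℂ) • (p.1 : Cd (n + 1))) (p.2 : Cd (n + 1)) : ℂ) := by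
    intro m
    refine (hf.comp continuous_snd).mul (Complex.continuous_ofReal.comp ?_)
    exact continuous_invPoissonKernel (by fun_prop) (by fun_prop) (fun p ↦ hz m p.1)
      fun p ↦ (norm_eq_of_mem_sphere p.2).le
  -- Fubini and the symmetry of the kernel move the Poisson integral from μ onto f, where the
  -- approximate identity applies pointwise in η.
  have hswap : ∀ m, ∫ ζ : UnitSphere (n + 1), f ζ * (u ((r m : ℂ) • (ζ : Cd (n + 1))) : ℂ)
      ∂sphereMeasure (n + 1) = ∫ η, ∫ ζ : UnitSphere (n + 1),
      f ζ * (invPoissonKernel ((r m : ℂ) • (η : Cd (n + 1))) (ζ : Cd (n + 1)) : ℂ)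
      ∂sphereMeasure (n + 1) ∂μ := by
    intro m
    rw [integral_integral_swap (integrable_of_continuous (hPc m))]
    refine integral_congr_ae (Eventually.of_forall fun ζ ↦ ?_)
    simp only
    rw [integral_const_mul, integral_complex_ofReal, ← hμ _ (mem_ball_zero_iff.2 (hz m ζ)),
      invPoissonIntegral]
    simp_rw [invPoissonKernel_symm (r m) _ ζ]
  simp_rw [hswap]
  refine tendsto_integral_of_dominated_convergence (fun _ ↦ C) (fun m ↦ ?_) (integrable_const _)
    (fun m ↦ Eventually.of_forall fun η ↦ ?_) (Eventually.of_forall fun η ↦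
      tendsto_integral_mul_invPoissonKernel hf hr0 hr1 hr η)
  · exact (integrable_of_continuous (μ := μ.prod (sphereMeasure (n + 1)))
      (hPc m)).integral_prod_left.aestronglyMeasurable
  · have hP : Continuous fun ζ : UnitSphere (n + 1) ↦
        invPoissonKernel ((r m : ℂ) • (η : Cd (n + 1))) (ζ : Cd (n + 1)) :=
      continuous_invPoissonKernel continuous_const continuous_subtype_val (fun _ ↦ hz m η)
        fun ζ ↦ (norm_eq_of_mem_sphere ζ).le
    calc _ ≤ ∫ ζ : UnitSphere (n + 1),
          C * invPoissonKernel ((r m : ℂ) • (η : Cd (n + 1))) (ζ : Cd (n + 1))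
          ∂sphereMeasure (n + 1) :=
          norm_integral_le_of_norm_le (integrable_of_continuous (by fun_prop))
            (Eventually.of_forall fun ζ ↦ by
              rw [norm_mul, Complex.norm_real,
                Real.norm_of_nonneg (invPoissonKernel_nonneg (hz m η) _)]
              exact mul_le_mul_of_nonneg_right (hC ζ) (invPoissonKernel_nonneg (hz m η) _))
      _ = C := by rw [integral_const_mul, integral_invPoissonKernel (hz m η), mul_one]

/-- A finite measure on the sphere is determined by its invariant Poisson integral. -/
lemma eq_of_invPoissonIntegral_eq {μ ν : Measure (UnitSphere (n + 1))} [IsFiniteMeasure μ]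
    [IsFiniteMeasure ν]
    (h : ∀ z ∈ unitBall (n + 1), invPoissonIntegral μ z = invPoissonIntegral ν z) : μ = ν := by
  obtain ⟨r, -, hr01, hr⟩ := exists_seq_strictMono_tendsto' (zero_lt_one (α := ℝ))
  refine ext_of_forall_integral_eq_of_IsFiniteMeasure fun f ↦ ?_
  have hf : Continuous fun ζ ↦ (f ζ : ℂ) := by fun_prop
  have h1 := tendsto_integral_mul_of_invPoissonIntegral_eq h hf (fun m ↦ (hr01 m).1.le)
    (fun m ↦ (hr01 m).2) hr
  have h2 := tendsto_integral_mul_of_invPoissonIntegral_eq (μ := ν) (fun _ _ ↦ rfl) hf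
    (fun m ↦ (hr01 m).1.le) (fun m ↦ (hr01 m).2) hr
  have := tendsto_nhds_unique h1 h2
  rw [integral_complex_ofReal, integral_complex_ofReal] at this
  exact_mod_cast this

end Representation

/-! ### Clark measures and their disintegration formula. -/

section Clark

lemma sub_ne_zero_of_norm_lt_one (α : UnitCircle) {w : ℂ} (hw : ‖w‖ < 1) : (α : ℂ) - w ≠ 0 := by
  intro h
  rw [← sub_eq_zero.1 h, norm_eq_of_mem_sphere] at hw
  exact lt_irrefl _ hw

lemma re_add_div_sub_nonneg (α : UnitCircle) {w : ℂ} (hw : ‖w‖ < 1) :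
    0 ≤ (((α : ℂ) + w) / ((α : ℂ) - w)).re := by
  have h : Complex.normSq (α : ℂ) = 1 := by
    rw [Complex.normSq_eq_norm_sq, norm_eq_of_mem_sphere, one_pow]
  have h2 : Complex.normSq w ≤ 1 := by
    rw [Complex.normSq_eq_norm_sq]
    nlinarith [norm_nonneg w]
  rw [Complex.div_re, ← add_div]
  refine div_nonneg ?_ (Complex.normSq_nonneg _)
  rw [Complex.normSq_apply] at h h2
  simp only [Complex.add_re, Complex.sub_re, Complex.add_im, Complex.sub_im]
  nlinarith

lemma norm_add_div_sub_le (α : UnitCircle) {w : ℂ} (hw : ‖w‖ < 1) :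
    ‖((α : ℂ) + w) / ((α : ℂ) - w)‖ ≤ 2 / (1 - ‖w‖) := by
  rw [norm_div]
  have h1 := norm_add_le (α : ℂ) w
  have h2 := norm_sub_norm_le (α : ℂ) w
  rw [norm_eq_of_mem_sphere] at h1 h2
  have : 0 < 1 - ‖w‖ := by linarith
  gcongr
  linarith

/-- For |c| = 1, rotating α by conj c has the same effect as replacing w by cw. The quotient is
holomorphic in c and equals 1 at c = 0, so the mean value property applies; the angle -θ below is
this conjugation. -/
lemma integral_re_add_div_sub {w : ℂ} (hw : ‖w‖ < 1) :
    ∫ α : UnitCircle, (((α : ℂ) + w) / ((α : ℂ) - w)).re ∂circleMeasure = 1 := by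
  have hc : Continuous fun α : UnitCircle ↦ ((α : ℂ) + w) / ((α : ℂ) - w) :=
    Continuous.div (by fun_prop) (by fun_prop) fun α ↦ sub_ne_zero_of_norm_lt_one α hw
  have h : ∫ α : UnitCircle, ((α : ℂ) + w) / ((α : ℂ) - w) ∂circleMeasure = 1 := by
    rw [integral_eq_integral_center (T := fun θ ↦ sphereMap (rotation (Circle.exp (-θ))))
      (fun θ ↦ measurePreserving_rotation _) hc
      (G := fun α c ↦ ((α : ℂ) + c * w) / ((α : ℂ) - c * w))]
    · have : ∀ α : UnitCircle, ((α : ℂ) + 0 * w) / ((α : ℂ) - 0 * w) = 1 := fun α ↦ by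
        rw [zero_mul, add_zero, sub_zero, div_self (ne_zero_of_mem_unit_sphere α)]
      simp_rw [this]
      simp
    · refine hc.comp (Continuous.subtype_mk ?_ _)
      simp only [rotation_apply]
      fun_prop
    · intro α
      refine DifferentiableOn.diffContOnCl fun c hc ↦ DifferentiableAt.differentiableWithinAt ?_
      rw [closure_ball _ one_ne_zero, mem_closedBall_zero_iff] at hc
      refine DifferentiableAt.div (by fun_prop) (by fun_prop)
        (sub_ne_zero_of_norm_lt_one α ?_)
      rw [norm_mul]
      exact (mul_le_of_le_one_left (norm_nonneg _) hc).trans_lt hw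
    · intro θ α
      have hθ : circleMap 0 1 θ * (Circle.exp (-θ) : ℂ) = 1 := by
        rw [Circle.coe_exp, circleMap_zero, Complex.ofReal_one, one_mul, ← Complex.exp_add]
        simp
      have hne : circleMap 0 1 θ ≠ 0 := left_ne_zero_of_mul_eq_one hθ
      rw [coe_sphereMap, rotation_apply, ← mul_div_mul_left _ _ hne, mul_add, mul_sub, ← mul_assoc,
        hθ, one_mul]
  have h2 := integral_re (integrable_of_continuous (μ := circleMeasure) hc)
  rw [h] at h2
  simpa using h2

variable {n : ℕ} {φ : Cd (n + 1) → ℂ}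

lemma existsUnique_isClarkMeasure (hφ : DifferentiableOn ℂ φ (unitBall (n + 1)))
    (hφ_maps : Set.MapsTo φ (unitBall (n + 1)) (ball (0 : ℂ) 1)) (α : UnitCircle) :
    ∃! μ : Measure (UnitSphere (n + 1)), IsClarkMeasure φ α μ := by
  have hlt : ∀ z ∈ unitBall (n + 1), ‖φ z‖ < 1 := fun z hz ↦ mem_ball_zero_iff.1 (hφ_maps hz)
  obtain ⟨μ, hμ⟩ := exists_isFiniteMeasure_invPoissonIntegral_eq
    (H := fun z ↦ ((α : ℂ) + φ z) / ((α : ℂ) - φ z))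
    (differentiableOn_div (hφ.const_add _) (hφ.const_sub _) fun z hz ↦ sub_ne_zero_of_norm_lt_one α (hlt z hz))
    fun z hz ↦ re_add_div_sub_nonneg α (hlt z hz)
  refine ⟨μ, hμ, fun ν hν ↦ ?_⟩
  have := hμ.1
  have := hν.1
  exact eq_of_invPoissonIntegral_eq fun z hz ↦ (hν.2 z hz).trans (hμ.2 z hz).symm

lemma isClarkMeasure_clarkMeasure (hφ : DifferentiableOn ℂ φ (unitBall (n + 1)))
    (hφ_maps : Set.MapsTo φ (unitBall (n + 1)) (ball (0 : ℂ) 1)) (α : UnitCircle) :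
    IsClarkMeasure φ α (clarkMeasure φ α) := by
  have h : ∃ μ, IsClarkMeasure φ α μ := (existsUnique_isClarkMeasure hφ hφ_maps α).exists
  rw [clarkMeasure, dif_pos h]
  exact h.choose_spec

/-- Disintegration of the normalized Lebesgue measure into Clark measures. -/
lemma integrable_and_integral_clarkMeasure (hφ : DifferentiableOn ℂ φ (unitBall (n + 1)))
    (hφ_maps : Set.MapsTo φ (unitBall (n + 1)) (ball (0 : ℂ) 1)) (f : C(UnitSphere (n + 1), ℂ)) :
    Integrable (fun α : UnitCircle ↦ ∫ ζ, f ζ ∂(clarkMeasure φ α)) circleMeasure ∧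
      ∫ α : UnitCircle, (∫ ζ, f ζ ∂(clarkMeasure φ α)) ∂circleMeasure =
        ∫ ζ, f ζ ∂(sphereMeasure (n + 1)) := by
  have hlt : ∀ z ∈ unitBall (n + 1), ‖φ z‖ < 1 := fun z hz ↦ mem_ball_zero_iff.1 (hφ_maps hz)
  obtain ⟨r, -, hr01, hr⟩ := exists_seq_strictMono_tendsto' (zero_lt_one (α := ℝ))
  have hmem : ∀ m (ζ : UnitSphere (n + 1)), (r m : ℂ) • (ζ : Cd (n + 1)) ∈ unitBall (n + 1) :=
    fun m ζ ↦ mem_ball_zero_iff.2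
      (norm_smul_lt_one (hr01 m).1.le (hr01 m).2 (norm_eq_of_mem_sphere ζ).le)
  have hclark := isClarkMeasure_clarkMeasure hφ hφ_maps
  let u : UnitCircle → Cd (n + 1) → ℝ := fun α z ↦ (((α : ℂ) + φ z) / ((α : ℂ) - φ z)).re
  let A : ℕ → UnitCircle → ℂ := fun m α ↦ ∫ ζ : UnitSphere (n + 1),
    f ζ * (u α ((r m : ℂ) • (ζ : Cd (n + 1))) : ℂ) ∂sphereMeasure (n + 1)
  have hA : ∀ α, Tendsto (fun m ↦ A m α) atTop (𝓝 (∫ ζ, f ζ ∂(clarkMeasure φ α))) := fun α ↦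
    have := (hclark α).1
    tendsto_integral_mul_of_invPoissonIntegral_eq (hclark α).2 f.continuous
      (fun m ↦ (hr01 m).1.le) (fun m ↦ (hr01 m).2) hr
  have hcont : ∀ m, Continuous fun p : UnitCircle × UnitSphere (n + 1) ↦
      f p.2 * (u p.1 ((r m : ℂ) • (p.2 : Cd (n + 1))) : ℂ) := by
    intro m
    have h1 : Continuous fun p : UnitCircle × UnitSphere (n + 1) ↦
        φ ((r m : ℂ) • (p.2 : Cd (n + 1))) :=
      hφ.continuousOn.comp_continuous (by fun_prop) fun p ↦ hmem m p.2
    have h2 : Continuous fun p : UnitCircle × UnitSphere (n + 1) ↦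
        ((p.1 : ℂ) + φ ((r m : ℂ) • (p.2 : Cd (n + 1)))) /
          ((p.1 : ℂ) - φ ((r m : ℂ) • (p.2 : Cd (n + 1)))) :=
      Continuous.div ((continuous_subtype_val.comp continuous_fst).add h1)
        ((continuous_subtype_val.comp continuous_fst).sub h1) fun p ↦
        sub_ne_zero_of_norm_lt_one p.1 (hlt _ (hmem m p.2))
    exact (f.continuous.comp continuous_snd).mul
      (Complex.continuous_ofReal.comp (Complex.continuous_re.comp h2))
  have hint : ∀ m, Integrable (fun p : UnitCircle × UnitSphere (n + 1) ↦
      f p.2 * (u p.1 ((r m : ℂ) • (p.2 : Cd (n + 1))) : ℂ))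
      (circleMeasure.prod (sphereMeasure (n + 1))) := fun m ↦ integrable_of_continuous (hcont m)
  have hAint : ∀ m, Integrable (A m) circleMeasure := fun m ↦ (hint m).integral_prod_left
  have hAval : ∀ m, ∫ α, A m α ∂circleMeasure = ∫ ζ, f ζ ∂(sphereMeasure (n + 1)) := by
    intro m
    rw [integral_integral_swap (hint m)]
    refine integral_congr_ae (Eventually.of_forall fun ζ ↦ ?_)
    simp only
    rw [integral_const_mul, integral_complex_ofReal, integral_re_add_div_sub (hlt _ (hmem m ζ))]
    simp
  -- The density is nonnegative with total mass Re((α + φ(0))/(α - φ(0))), whatever m is, and this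
  -- is bounded uniformly in α because |φ(0)| < 1.
  have hAbound : ∀ m α, ‖A m α‖ ≤ ‖f‖ * (2 / (1 - ‖φ 0‖)) := by
    intro m α
    have hH : DifferentiableOn ℂ (fun z ↦ ((α : ℂ) + φ z) / ((α : ℂ) - φ z)) (unitBall (n + 1)) :=
      differentiableOn_div (hφ.const_add _) (hφ.const_sub _) fun z hz ↦ sub_ne_zero_of_norm_lt_one α (hlt z hz)
    have h1 := integral_invPoissonKernel_mul_re hH (hr01 m).1.le (hr01 m).2 (z := 0) (by simp)
    simp only [invPoissonKernel_zero, mul_one, smul_zero] at h1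
    have h2 : Continuous fun ζ : UnitSphere (n + 1) ↦ u α ((r m : ℂ) • (ζ : Cd (n + 1))) :=
      Complex.continuous_re.comp (hH.continuousOn.comp_continuous (by fun_prop) (hmem m))
    have h0 : ‖φ 0‖ < 1 := hlt 0 (by simp)
    calc ‖A m α‖ ≤ ∫ ζ : UnitSphere (n + 1), ‖f‖ * u α ((r m : ℂ) • (ζ : Cd (n + 1)))
          ∂sphereMeasure (n + 1) :=
          norm_integral_le_of_norm_le (integrable_of_continuous (continuous_const.mul h2))
            (Eventually.of_forall fun ζ ↦ by
              have h3 := re_add_div_sub_nonneg α (hlt _ (hmem m ζ))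
              rw [norm_mul, Complex.norm_real, Real.norm_of_nonneg h3]
              exact mul_le_mul_of_nonneg_right (f.norm_coe_le_norm ζ) h3)
      _ = ‖f‖ * u α 0 := by rw [integral_const_mul, h1]
      _ ≤ _ := by
          gcongr
          exact (Complex.re_le_norm _).trans (norm_add_div_sub_le α h0)
  constructor
  -- Each Clark measure comes from a choice, so measurability in α is obtained from the pointwise
  -- limit of the functions `A m`.
  · refine Integrable.of_bound (C := ‖f‖ * (2 / (1 - ‖φ 0‖))) (aestronglyMeasurable_of_tendsto_ae
      atTop (fun m ↦ (hAint m).aestronglyMeasurable) (Eventually.of_forall hA))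
      (Eventually.of_forall fun α ↦ ?_)
    exact le_of_tendsto (hA α).norm (Eventually.of_forall fun m ↦ hAbound m α)
  · refine tendsto_nhds_unique (tendsto_integral_of_dominated_convergence
      (fun _ ↦ ‖f‖ * (2 / (1 - ‖φ 0‖))) (fun m ↦ (hAint m).aestronglyMeasurable)
      (integrable_const _) (fun m ↦ Eventually.of_forall (hAbound m)) (Eventually.of_forall hA)) ?_
    simp_rw [hAval]
    exact tendsto_const_nhds

end Clark

end ClarkSphere

end

open ClarkSphere in
theorem mainTheorem10 (d : ℕ) (hd : 1 ≤ d) (φ : Cd d → ℂ)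
    (hφ : DifferentiableOn ℂ φ (unitBall d))
    (hφ_maps : Set.MapsTo φ (unitBall d) (Metric.ball (0 : ℂ) 1)) :
    (∀ α : UnitCircle, ∃! μ : Measure (UnitSphere d), IsClarkMeasure φ α μ) ∧
    ∀ f : C(UnitSphere d, ℂ),
      Integrable (fun α : UnitCircle => ∫ ζ, f ζ ∂(clarkMeasure φ α)) circleMeasure ∧
      ∫ α : UnitCircle, (∫ ζ, f ζ ∂(clarkMeasure φ α)) ∂circleMeasure =
        ∫ ζ, f ζ ∂(sphereMeasure d) := by
  obtain ⟨n, rfl⟩ := Nat.exists_eq_add_of_le' hd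
  exact ⟨existsUnique_isClarkMeasure hφ hφ_maps, integrable_and_integral_clarkMeasure hφ hφ_maps⟩
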